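/- Let $n\ge 3$, and let $L(n)$ be the lattice of partitions $a=(a_1\ge\dots\ge a_n\ge 0)$ of $n$ under the dominance order ($a\le b$ iff $\sum_{i\le j}a_i\le\sum_{i\le j}b_i$ for all $j$). Let $J$ and $M$ be the sets of completely join-irreducible and completely meet-irreducible elements of $L(n)$, and let $K(L(n))=(J,M,\le)$ be its standard context. For $g\in J$ put $g'=\{m\in M: g\le m\}$, and for $m\in M$ put $m'=\{g\in J: g\le m\}$. Write $g\swarrow m$ if $g\not\le m$ and $h\le m$ for all $h\in J$ with $g'\subsetneq h'$; write $g\nearrow m$ if $g\not\le m$ and $g\le k$ for all $k\in M$ with $m'\subsetneq k'$; and write $g\mathrel{\nearrow\!\!\!\!\!\swarrow}m$ (a double arrow) if both hold. A subcontext $(H,N)$ with $H\subseteq J$, $N\subseteq M$ (and the restricted incidence) is arrow-closed if $h\in H$, $h\nearrow m$ imply $m\in N$, and $n'\in N$, $g\swarrow n'$ imply $g\in H$. It is one-generated if it is the smallest arrow-closed subcontext containing some given single object $g\in J$, or some given single attribute $m\in M$; it has format $1\times1$ if $|H|=|N|=1$. Omitting zeros and writing $x^{e}$ for $e$ consecutive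 entries $x$, a partition has type A if it is $(k^{\ell})$ with $k\ge2$, $\ell\ge1$; type B if it is $(k^{b},(k-1)^{\ell})$ with $k\ge2$, $b,\ell\ge1$; type C if it is $(k,1^{d})$ with $k\ge3$, $d\ge1$; type D if it is $((k+1)^{b},k^{\ell},1^{d})$ with $k\ge3$, $b\ge0$, $\ell,d\ge1$, $b+\ell\ge2$; type I if it is $(t^{c})$ with $t\ge1$, $c\ge2$; type II if it is $(t^{c},r)$ with $t>r\ge1$, $c\ge1$; type III if it is $(a,1^{c})$ with $a\ge2$, $c\ge2$. Then: 1. $K(L(n))$ has exactly $2n-4$ one-generated arrow-closed subcontexts of format $1\times1$. 2. The double arrows are one-to-one between the elements of $J$ of types A, B, C and the elements of $M$ of types I, II, III: every $g\in J$ of type A, B or C is in double arrow relation to exactly one $m\in M$, every $m\in M$ of type I, II or III is in double arrow relation to exactly one $g\in J$, and whenever $g\in J$ and $m\in M$ are in double arrow relation, $g$ has type A, B or C if and only if $m$ has type I, II or III. 3. If $g\in J$ has type A, B or C, and $m\in M$ is in double arrow relation to $g$, then the arrow-closed subcontext generated by $g$ is $(\{g\},\{m\})$; and every one-generated arrow-closed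 subcontext of format $1\times 1$ is of this form. 4. For every $g\in J$ of type D there are at least two distinct $m\in M$ with $g\nearrow m$. -/

import Mathlib

/-! ### Formal contexts: arrow relations and arrow-closed subcontexts

A formal context with objects `G`, attributes `M` and incidence `I` is given by the relation
`I : G → M → Prop`; the derivation `g'` is `upperPolar I {g}`, and `m'` is `lowerPolar I {m}`. -/

section Context

variable {G M : Type*}

/-- `g ↙ m`: the object `g` does not have the attribute `m`, and every object `h` whose intent
properly contains that of `g` has the attribute `m`. -/
def DownArrow (I : G → M → Prop) (g : G) (m : M) : Prop :=
  ¬ I g m ∧ ∀ h : G, upperPolar I {g} ⊂ upperPolar I {h} → I h m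

/-- `g ↗ m`: the object `g` does not have the attribute `m`, and `g` has every attribute `k`
whose extent properly contains that of `m`. -/
def UpArrow (I : G → M → Prop) (g : G) (m : M) : Prop :=
  ¬ I g m ∧ ∀ k : M, lowerPolar I {m} ⊂ lowerPolar I {k} → I g k

/-- The double arrow relation. -/
def DoubleArrow (I : G → M → Prop) (g : G) (m : M) : Prop :=
  UpArrow I g m ∧ DownArrow I g m

/-- A subcontext `(H, N, I ∩ (H × N))` is represented by the pair `(H, N)`. It is arrow-closed if
`h ↗ m` with `h ∈ H` implies `m ∈ N`, and `g ↙ n` with `n ∈ N` implies `g ∈ H`. -/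
def ArrowClosed (I : G → M → Prop) (S : Set G × Set M) : Prop :=
  (∀ h ∈ S.1, ∀ m, UpArrow I h m → m ∈ S.2) ∧ (∀ n ∈ S.2, ∀ g, DownArrow I g n → g ∈ S.1)

/-- `S` is the smallest arrow-closed subcontext containing the objects `G₁` and the
attributes `M₁`. -/
def IsArrowClosure (I : G → M → Prop) (G₁ : Set G) (M₁ : Set M) (S : Set G × Set M) : Prop :=
  IsLeast {T : Set G × Set M | ArrowClosed I T ∧ G₁ ⊆ T.1 ∧ M₁ ⊆ T.2} S

/-- The subcontext is generated as an arrow-closed subcontext by a single object or by a single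
attribute. -/
def IsOneGenerated (I : G → M → Prop) (S : Set G × Set M) : Prop :=
  (∃ g : G, IsArrowClosure I {g} ∅ S) ∨ (∃ m : M, IsArrowClosure I ∅ {m} S)

/-- The subcontext has exactly one object and exactly one attribute. -/
def IsOneByOne (S : Set G × Set M) : Prop :=
  S.1.ncard = 1 ∧ S.2.ncard = 1

end Context

/-! ### The standard context -/

section Standard

variable {L : Type*} [PartialOrder L]

/-- `a` belongs to every set whose supremum is `a`. -/
def CompletelyJoinIrreducible (a : L) : Prop :=
  ∀ S : Set L, IsLUB S a → a ∈ S

/-- `a` belongs to every set whose infimum is `a`. -/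
def CompletelyMeetIrreducible (a : L) : Prop :=
  ∀ S : Set L, IsGLB S a → a ∈ S

end Standard

/-- The type of completely join-irreducible elements. -/
abbrev JoinIrr (L : Type*) [PartialOrder L] : Type _ := {a : L // CompletelyJoinIrreducible a}

/-- The type of completely meet-irreducible elements. -/
abbrev MeetIrr (L : Type*) [PartialOrder L] : Type _ := {a : L // CompletelyMeetIrreducible a}

/-- The standard context: objects are the completely join-irreducible elements, attributes are
the completely meet-irreducible elements, and the incidence is the order. -/
def stdContext (L : Type*) [PartialOrder L] : JoinIrr L → MeetIrr L → Prop :=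
  fun g m => g.1 ≤ m.1

/-! ### Integer partitions under the dominance order -/

/-- A partition `a₁ ≥ a₂ ≥ ⋯ ≥ aₙ ≥ 0` of `n`. The entry `aᵢ` is `part (i - 1)`; the `n`-tuple is
continued by zeros beyond its last entry. -/
@[ext]
structure IntPartition (n : ℕ) where
  part : ℕ → ℕ
  antitone_part : Antitone part
  part_eq_zero : ∀ i, n ≤ i → part i = 0
  sum_part : ∑ i ∈ Finset.range n, part i = n

namespace IntPartition

variable {n : ℕ}

/-- The dominance order: comparison of all initial sums. (The sums of `j > n` entries are all
equal to `n`, so that it does not matter whether they are included.) -/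
instance : PartialOrder (IntPartition n) where
  le a b := ∀ j : ℕ, ∑ i ∈ Finset.range j, a.part i ≤ ∑ i ∈ Finset.range j, b.part i
  le_refl _ _ := le_rfl
  le_trans _ _ _ hab hbc j := (hab j).trans (hbc j)
  le_antisymm a b hab hba := by
    have h : ∀ j : ℕ, ∑ i ∈ Finset.range j, a.part i = ∑ i ∈ Finset.range j, b.part i :=
      fun j => le_antisymm (hab j) (hba j)
    ext i
    have h1 := h (i + 1)
    rw [Finset.sum_range_succ, Finset.sum_range_succ, h i] at h1
    exact Nat.add_left_cancel h1

/-- Type A: `(k, …, k)` with `ℓ ≥ 1` entries, `k ≥ 2`. -/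
def TypeA (a : IntPartition n) : Prop :=
  ∃ k l : ℕ, 2 ≤ k ∧ 1 ≤ l ∧ ∀ i, a.part i = if i < l then k else 0

/-- Type B: `b ≥ 1` entries `k` followed by `ℓ ≥ 1` entries `k - 1`, `k ≥ 2`. -/
def TypeB (a : IntPartition n) : Prop :=
  ∃ k b l : ℕ, 2 ≤ k ∧ 1 ≤ b ∧ 1 ≤ l ∧
    ∀ i, a.part i = if i < b then k else if i < b + l then k - 1 else 0

/-- Type C: one entry `k ≥ 3` followed by `d ≥ 1` entries `1`. -/
def TypeC (a : IntPartition n) : Prop :=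
  ∃ k d : ℕ, 3 ≤ k ∧ 1 ≤ d ∧
    ∀ i, a.part i = if i < 1 then k else if i < 1 + d then 1 else 0

/-- Type D: `b ≥ 0` entries `k + 1`, then `ℓ ≥ 1` entries `k`, then `d ≥ 1` entries `1`,
where `k ≥ 3` and `b + ℓ ≥ 2`. -/
def TypeD (a : IntPartition n) : Prop :=
  ∃ k b l d : ℕ, 3 ≤ k ∧ 2 ≤ b + l ∧ 1 ≤ l ∧ 1 ≤ d ∧
    ∀ i, a.part i = if i < b then k + 1 else if i < b + l then k
      else if i < b + l + d then 1 else 0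

/-- Type I: `c ≥ 2` equal entries `t ≥ 1`. -/
def TypeI (a : IntPartition n) : Prop :=
  ∃ t c : ℕ, 1 ≤ t ∧ 2 ≤ c ∧ ∀ i, a.part i = if i < c then t else 0

/-- Type II: `c ≥ 1` equal entries `t` followed by one entry `r` with `t > r ≥ 1`. -/
def TypeII (a : IntPartition n) : Prop :=
  ∃ t r c : ℕ, 1 ≤ r ∧ r < t ∧ 1 ≤ c ∧
    ∀ i, a.part i = if i < c then t else if i < c + 1 then r else 0

/-- Type III: one entry `e ≥ 2` followed by `c ≥ 2` entries `1`. -/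
def TypeIII (a : IntPartition n) : Prop :=
  ∃ e c : ℕ, 2 ≤ e ∧ 2 ≤ c ∧
    ∀ i, a.part i = if i < 1 then e else if i < 1 + c then 1 else 0

/-- Type A, B or C. -/
def TypeABC (a : IntPartition n) : Prop :=
  a.TypeA ∨ a.TypeB ∨ a.TypeC

/-- Type I, II or III. -/
def TypeI_III (a : IntPartition n) : Prop :=
  a.TypeI ∨ a.TypeII ∨ a.TypeIII

end IntPartition

/-! ### Prime pairs in a partial order -/

section PrimePair

variable {L : Type*} [PartialOrder L]

/-! In a finite lattice, a 1×1 arrow-closed subcontext is the same as a prime pair: some `g` and `m`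
whose principal filter and principal ideal partition the lattice. If `g` has only one up-arrow, to
`m`, then every `y` not above `g` lies below some target of an up-arrow from `g`, hence below `m`.
Conversely, in a prime pair the up-arrow from `g` and the down-arrow into `m` are unique.

For partitions there are two families of prime pairs. "At most `s` parts" is the filter of the most
even partition into `s` parts (types A, B), and its complement is the ideal of the hook with first
part `n - s`. "First part greater than `t`" is the filter of the hook with first part `t + 1`, and
its complement is the ideal of the greedy partition with parts at most `t`.

No others exist (`typeABC_of_primePair`): in a prime pair, `g` is the least partition whose `j`-th
initial sum reaches some value `q`, and concavity of initial sums leaves only the extreme cases. The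
count is `(n - 1) + (n - 3)`. Type D partitions are neither balanced nor hooks, so they have two
up-arrows. -/

/-- The order is the disjoint union of the principal filter of `g` and the principal ideal
of `m`. -/
def PrimePair (g m : L) : Prop :=
  ∀ x, x ≤ m ↔ ¬ g ≤ x

theorem PrimePair.not_le {g m : L} (h : PrimePair g m) : ¬ g ≤ m :=
  (h m).1 le_rfl

theorem PrimePair.right_unique {g m k : L} (h : PrimePair g m) (h' : PrimePair g k) : m = k :=
  le_antisymm ((h' m).2 h.not_le) ((h k).2 h'.not_le)

/-- If `g` is the supremum of a set avoiding it, all members of the set are strictly below `g`,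
hence below `m`; then so is `g`. -/
theorem PrimePair.completelyJoinIrreducible {g m : L} (h : PrimePair g m) :
    CompletelyJoinIrreducible g := by
  intro S hS
  by_contra hg
  refine h.not_le (hS.2 fun s hs => (h s).2 fun hgs => hg ?_)
  rwa [le_antisymm hgs (hS.1 hs)]

theorem PrimePair.completelyMeetIrreducible {g m : L} (h : PrimePair g m) :
    CompletelyMeetIrreducible m := by
  intro S hS
  by_contra hm
  refine h.not_le (hS.2 fun s hs => ?_)
  by_contra hgs
  have := (h s).2 hgs
  exact hm (by rwa [le_antisymm (hS.1 hs) this])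

/-! ### Density of irreducibles, and arrows in the standard context -/

/-- The completely join-irreducible elements are join-dense. -/
theorem le_of_forall_completelyJoinIrreducible [WellFoundedLT L] (x : L) :
    ∀ y : L, (∀ j : L, CompletelyJoinIrreducible j → j ≤ x → j ≤ y) → x ≤ y := by
  induction x using WellFoundedLT.induction with
  | ind x ih =>
    intro y hy
    by_cases hx : CompletelyJoinIrreducible x
    · exact hy x hx le_rfl
    · simp only [CompletelyJoinIrreducible, not_forall] at hx
      obtain ⟨S, hS, hxS⟩ := hx
      refine hS.2 fun s hs => ?_
      have hlt : s < x := lt_of_le_of_ne (hS.1 hs) fun h => hxS (h ▸ hs)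
      exact ih s hlt y fun j hj hjs => hy j hj (hjs.trans hlt.le)

/-- The completely meet-irreducible elements are meet-dense. -/
theorem le_of_forall_completelyMeetIrreducible [WellFoundedGT L] (x : L) :
    ∀ y : L, (∀ j : L, CompletelyMeetIrreducible j → x ≤ j → y ≤ j) → y ≤ x := by
  induction x using WellFoundedGT.induction with
  | ind x ih =>
    intro y hy
    by_cases hx : CompletelyMeetIrreducible x
    · exact hy x hx le_rfl
    · simp only [CompletelyMeetIrreducible, not_forall] at hx
      obtain ⟨S, hS, hxS⟩ := hx
      refine hS.2 fun s hs => ?_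
      have hlt : x < s := lt_of_le_of_ne (hS.1 hs) fun h => hxS (h ▸ hs)
      exact ih s hlt y fun j hj hjs => hy j hj (hlt.le.trans hjs)

/-- By meet-density, inclusion of intents is the reversed order, so down-arrows can be read off the
order directly. -/
theorem upperPolar_stdContext_ssubset [WellFoundedGT L] {g h : JoinIrr L} :
    upperPolar (stdContext L) {g} ⊂ upperPolar (stdContext L) {h} ↔ h.1 < g.1 := by
  have key : ∀ a b : JoinIrr L,
      upperPolar (stdContext L) {a} ⊆ upperPolar (stdContext L) {b} ↔ b.1 ≤ a.1 := by
    intro a b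
    simp only [Set.subset_def, upperPolar, stdContext, Set.mem_singleton_iff, Set.mem_ofPred_eq,
      forall_eq]
    exact ⟨fun H => le_of_forall_completelyMeetIrreducible _ _ fun j hj => H ⟨j, hj⟩,
      fun H m hm => H.trans hm⟩
  rw [ssubset_iff_subset_not_subset, key, key, lt_iff_le_not_ge]

theorem lowerPolar_stdContext_ssubset [WellFoundedLT L] {m k : MeetIrr L} :
    lowerPolar (stdContext L) {m} ⊂ lowerPolar (stdContext L) {k} ↔ m.1 < k.1 := by
  have key : ∀ a b : MeetIrr L,
      lowerPolar (stdContext L) {a} ⊆ lowerPolar (stdContext L) {b} ↔ a.1 ≤ b.1 := by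
    intro a b
    simp only [Set.subset_def, lowerPolar, stdContext, Set.mem_singleton_iff, Set.mem_ofPred_eq,
      forall_eq]
    exact ⟨fun H => le_of_forall_completelyJoinIrreducible _ _ fun j hj => H ⟨j, hj⟩,
      fun H m hm => hm.trans H⟩
  rw [ssubset_iff_subset_not_subset, key, key, lt_iff_le_not_ge]

/-- The target of an up-arrow from `g` is not above `g`, so it is below `m`; were it strictly below,
maximality would force `g ≤ m`. -/
theorem PrimePair.upArrow_iff [WellFoundedLT L] {g : JoinIrr L} {m k : MeetIrr L}
    (h : PrimePair g.1 m.1) : UpArrow (stdContext L) g k ↔ k = m := by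
  simp only [UpArrow, lowerPolar_stdContext_ssubset, stdContext]
  constructor
  · rintro ⟨h1, h2⟩
    have hkm := (h k.1).2 h1
    by_contra hne
    exact h.not_le (h2 m (lt_of_le_of_ne hkm fun e => hne (Subtype.ext e)))
  · rintro rfl
    exact ⟨h.not_le, fun j hj => by_contra fun hg => hj.not_ge ((h j.1).2 hg)⟩

theorem PrimePair.downArrow_iff [WellFoundedGT L] {g k : JoinIrr L} {m : MeetIrr L}
    (h : PrimePair g.1 m.1) : DownArrow (stdContext L) k m ↔ k = g := by
  simp only [DownArrow, upperPolar_stdContext_ssubset, stdContext]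
  constructor
  · rintro ⟨h1, h2⟩
    have hgk : g.1 ≤ k.1 := by_contra fun hg => h1 ((h k.1).2 hg)
    by_contra hne
    exact h.not_le (h2 g (lt_of_le_of_ne hgk fun e => hne (Subtype.ext e.symm)))
  · rintro rfl
    exact ⟨h.not_le, fun j hj => (h j.1).2 hj.not_ge⟩

theorem PrimePair.doubleArrow [WellFoundedLT L] [WellFoundedGT L] {g : JoinIrr L} {m : MeetIrr L}
    (h : PrimePair g.1 m.1) : DoubleArrow (stdContext L) g m :=
  ⟨h.upArrow_iff.2 rfl, h.downArrow_iff.2 rfl⟩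

theorem PrimePair.isArrowClosure [WellFoundedLT L] [WellFoundedGT L] {g : JoinIrr L}
    {m : MeetIrr L} (h : PrimePair g.1 m.1) :
    IsArrowClosure (stdContext L) {g} ∅ ({g}, {m}) := by
  refine ⟨⟨⟨?_, ?_⟩, subset_rfl, Set.empty_subset _⟩, ?_⟩
  · rintro _ rfl k hk
    exact h.upArrow_iff.1 hk
  · rintro _ rfl k hk
    exact h.downArrow_iff.1 hk
  · rintro T ⟨hT, hgT, -⟩
    have hg : g ∈ T.1 := hgT rfl
    exact ⟨hgT, Set.singleton_subset_iff.2 (hT.1 g hg m (h.upArrow_iff.2 rfl))⟩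

/-- A maximal element among those above `x` and not above `g` works: everything strictly above it is
above `g`, which also makes it meet-irreducible. -/
theorem exists_upArrow [WellFoundedLT L] [WellFoundedGT L] (g : JoinIrr L) {x : L}
    (hx : ¬ g.1 ≤ x) : ∃ m : MeetIrr L, x ≤ m.1 ∧ UpArrow (stdContext L) g m := by
  obtain ⟨y, ⟨hxy, hgy⟩, hmax⟩ :=
    (wellFounded_gt (α := L)).has_min {y | x ≤ y ∧ ¬ g.1 ≤ y} ⟨x, le_rfl, hx⟩
  have habove : ∀ z, y < z → g.1 ≤ z := fun z hz =>
    by_contra fun hg => hmax z ⟨hxy.trans hz.le, hg⟩ hz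
  have hy : CompletelyMeetIrreducible y := by
    intro S hS
    by_contra hyS
    exact hgy (hS.2 fun s hs => habove s (lt_of_le_of_ne (hS.1 hs) fun e => hyS (e ▸ hs)))
  refine ⟨⟨y, hy⟩, hxy, hgy, fun k hk => habove k.1 ?_⟩
  exact lowerPolar_stdContext_ssubset.1 hk

/-- A completely join-irreducible element with at most one up-arrow belongs to a prime pair. -/
theorem exists_primePair_of_upArrow_unique [WellFoundedLT L] [WellFoundedGT L] (g : JoinIrr L)
    (h : ∀ k₁ k₂ : MeetIrr L, UpArrow (stdContext L) g k₁ → UpArrow (stdContext L) g k₂ → k₁ = k₂) :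
    ∃ m : MeetIrr L, PrimePair g.1 m.1 ∧ UpArrow (stdContext L) g m := by
  -- `g` is not the least element, which is the supremum of the empty set.
  obtain ⟨x, hx⟩ : ∃ x, ¬ g.1 ≤ x := by
    by_contra! hall
    exact g.2 ∅ ⟨fun _ h => h.elim, fun x _ => hall x⟩
  obtain ⟨m, -, hm⟩ := exists_upArrow g hx
  refine ⟨m, fun y => ⟨fun hy hg => hm.1 (hg.trans hy), fun hy => ?_⟩, hm⟩
  obtain ⟨k, hyk, hk⟩ := exists_upArrow g hy
  rwa [h m k hm hk]

theorem ArrowClosed.exists_primePair [WellFoundedLT L] [WellFoundedGT L]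
    {S : Set (JoinIrr L) × Set (MeetIrr L)} (hS : ArrowClosed (stdContext L) S)
    (h1 : IsOneByOne S) :
    ∃ (g : JoinIrr L) (m : MeetIrr L), PrimePair g.1 m.1 ∧ S = ({g}, {m}) := by
  obtain ⟨g, hg⟩ := Set.ncard_eq_one.1 h1.1
  obtain ⟨m, hm⟩ := Set.ncard_eq_one.1 h1.2
  have hup : ∀ k, UpArrow (stdContext L) g k → k = m := fun k hk => by
    have := hS.1 g (by rw [hg]; rfl) k hk
    rwa [hm] at this
  obtain ⟨k, hk, hgk⟩ := exists_primePair_of_upArrow_unique g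
    fun k₁ k₂ h₁ h₂ => (hup k₁ h₁).trans (hup k₂ h₂).symm
  obtain rfl := hup k hgk
  exact ⟨g, k, hk, Prod.ext hg hm⟩

theorem IsOneGenerated.arrowClosed {G M : Type*} {I : G → M → Prop} {S : Set G × Set M}
    (h : IsOneGenerated I S) : ArrowClosed I S := by
  rcases h with ⟨_, h⟩ | ⟨_, h⟩ <;> exact h.1.1

end PrimePair

/-! ### Initial sums of partitions -/

namespace IntPartition

variable {n : ℕ}

/-- The sum of the first `j` entries. -/
def psum (a : IntPartition n) (j : ℕ) : ℕ :=
  ∑ i ∈ Finset.range j, a.part i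

theorem le_iff_psum {a b : IntPartition n} : a ≤ b ↔ ∀ j, a.psum j ≤ b.psum j :=
  Iff.rfl

@[simp]
theorem psum_zero (a : IntPartition n) : a.psum 0 = 0 := rfl

theorem psum_succ (a : IntPartition n) (j : ℕ) : a.psum (j + 1) = a.psum j + a.part j :=
  Finset.sum_range_succ _ _

theorem psum_one (a : IntPartition n) : a.psum 1 = a.part 0 := by
  rw [psum_succ, psum_zero, zero_add]

theorem psum_mono (a : IntPartition n) : Monotone a.psum :=
  monotone_nat_of_le_succ fun j => by rw [psum_succ]; exact Nat.le_add_right _ _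

theorem psum_of_le (a : IntPartition n) {j : ℕ} (hj : n ≤ j) : a.psum j = n := by
  induction j, hj using Nat.le_induction with
  | base => exact a.sum_part
  | succ j hj ih => rw [psum_succ, ih, a.part_eq_zero j hj, add_zero]

theorem psum_le (a : IntPartition n) (j : ℕ) : a.psum j ≤ n := by
  rcases le_total n j with h | h
  · exact (a.psum_of_le h).le
  · exact (a.psum_mono h).trans_eq (a.psum_of_le le_rfl)

theorem psum_add_le (a : IntPartition n) (i d : ℕ) :
    a.psum (i + d) ≤ a.psum i + d * a.part i := by
  induction d with
  | zero => simp
  | succ d ih =>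
    have := a.antitone_part (Nat.le_add_right i d)
    rw [← add_assoc, psum_succ, Nat.succ_mul]
    omega

theorem le_psum_add (a : IntPartition n) (i d : ℕ) {k : ℕ} (hk : i + d ≤ k + 1) :
    a.psum i + d * a.part k ≤ a.psum (i + d) := by
  induction d with
  | zero => simp
  | succ d ih =>
    have := a.antitone_part (show i + d ≤ k by omega)
    have := ih (by omega)
    rw [← add_assoc, psum_succ, Nat.succ_mul]
    omega

theorem psum_le_mul (a : IntPartition n) (i : ℕ) : a.psum i ≤ i * a.part 0 := by
  simpa using a.psum_add_le 0 i

theorem mul_le_psum (a : IntPartition n) {i k : ℕ} (hk : i ≤ k + 1) :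
    i * a.part k ≤ a.psum i := by
  simpa using a.le_psum_add 0 i (k := k) (by omega)

/-- Expresses "at most `s` nonzero parts" through an initial sum, the quantity that dominance
controls. -/
theorem psum_eq_iff (a : IntPartition n) {s : ℕ} : a.psum s = n ↔ a.part s = 0 := by
  constructor
  · intro h
    have h1 := a.psum_le (s + 1)
    rw [psum_succ] at h1
    omega
  · intro h
    have h1 := a.psum_add_le s n
    rw [a.psum_of_le (Nat.le_add_left n s), h] at h1
    have := a.psum_le s
    omega

theorem psum_concave (a : IntPartition n) (i : ℕ) :
    a.psum i + a.psum (i + 2) ≤ 2 * a.psum (i + 1) := by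
  have := a.antitone_part (Nat.le_succ i)
  rw [psum_succ a (i + 1), psum_succ a i]
  simp only [Nat.succ_eq_add_one] at this
  omega

/-- Either the entries have run out and the sum is `n`, or each of them is at least 1. Hooks attain
this bound. -/
theorem min_le_psum_succ (a : IntPartition n) (d : ℕ) :
    min n (a.part 0 + d) ≤ a.psum (d + 1) := by
  rcases Nat.eq_zero_or_pos (a.part d) with h | h
  · rw [← psum_eq_iff] at h
    have := a.psum_mono (Nat.le_succ d)
    simp only [Nat.succ_eq_add_one] at this
    omega
  · have h1 := a.le_psum_add 1 d (k := d) (by omega)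
    rw [psum_one, add_comm 1 d] at h1
    have : d * 1 ≤ d * a.part d := Nat.mul_le_mul_left d h
    omega

theorem psum_succ_le_of_part_one_le (a : IntPartition n) (h : a.part 1 ≤ 1) (d : ℕ) :
    a.psum (d + 1) ≤ a.part 0 + d := by
  have h1 := a.psum_add_le 1 d
  rw [psum_one, add_comm 1 d] at h1
  have : d * a.part 1 ≤ d * 1 := Nat.mul_le_mul_left d h
  omega

instance : Finite (IntPartition n) := by
  have hlt : ∀ (a : IntPartition n) i, a.part i < n + 1 := fun a i => by
    have h1 := a.psum_le (i + 1)
    rw [psum_succ] at h1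
    omega
  refine Finite.of_injective
    (fun (a : IntPartition n) (i : Fin n) => (⟨a.part i, hlt a i⟩ : Fin (n + 1))) ?_
  intro a b hab
  ext i
  by_cases hi : i < n
  · simpa using congrArg Fin.val (congrFun hab ⟨i, hi⟩)
  · rw [a.part_eq_zero i (by omega), b.part_eq_zero i (by omega)]

/-! ### Prime pairs of partitions -/

/-- The partition `g` is as even as possible on `s` entries, so it is the least one with at most `s`
parts. -/
theorem balanced_le_iff {g : IntPartition n} {s : ℕ} (hs : g.psum s = n)
    (hb : g.part 0 ≤ g.part (s - 1) + 1) (x : IntPartition n) : g ≤ x ↔ x.psum s = n := by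
  constructor
  · intro h
    have := le_iff_psum.1 h s
    have := x.psum_le s
    omega
  · intro h
    rw [le_iff_psum]
    intro i
    rcases le_or_gt s i with hi | hi
    · have := x.psum_mono hi
      have := g.psum_le i
      omega
    · obtain ⟨d, rfl⟩ := Nat.exists_eq_add_of_lt hi
      -- If `x.part i` exceeds the last entry of `g`, the first `i` entries of `x` are all at least
      -- `g.part 0`. Otherwise the entries of `x` from `i` to `s - 1` are at most those of `g`, and
      -- the totals agree.
      by_cases hx : g.part (i + d + 1 - 1) + 1 ≤ x.part i
      · calc g.psum i ≤ i * g.part 0 := g.psum_le_mul i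
          _ ≤ i * x.part i := Nat.mul_le_mul_left i (hb.trans hx)
          _ ≤ x.psum i := x.mul_le_psum (Nat.le_succ i)
      · have h1 := g.le_psum_add i (d + 1) (k := i + d + 1 - 1) (by omega)
        have h2 := x.psum_add_le i (d + 1)
        have h3 : (d + 1) * x.part i ≤ (d + 1) * g.part (i + d + 1 - 1) :=
          Nat.mul_le_mul_left _ (by omega)
        rw [← add_assoc] at h1 h2
        omega

theorem hook_le_iff {g : IntPartition n} (h : g.part 1 ≤ 1) (x : IntPartition n) :
    g ≤ x ↔ g.part 0 ≤ x.part 0 := by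
  constructor
  · intro hx
    have := le_iff_psum.1 hx 1
    rwa [psum_one, psum_one] at this
  · intro hx
    rw [le_iff_psum]
    rintro (_ | d)
    · simp
    · have := g.psum_succ_le_of_part_one_le h d
      have := x.min_le_psum_succ d
      have := g.psum_le (d + 1)
      omega

/-- The hook has `s`-th sum at most `n - 1`. Conversely, if `x` has more than `s` parts, each entry
after the first `d + 1`, up to index `s`, takes at least 1 away from the initial sum. -/
theorem le_hook_iff {m : IntPartition n} {s : ℕ} (h : m.part 1 ≤ 1) (h0 : m.part 0 + s = n)
    (hs : 1 ≤ s) (x : IntPartition n) : x ≤ m ↔ ¬ x.psum s = n := by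
  obtain ⟨s, rfl⟩ := Nat.exists_eq_add_of_le' hs
  constructor
  · intro hx
    have := le_iff_psum.1 hx (s + 1)
    have := m.psum_succ_le_of_part_one_le h s
    omega
  · intro hx
    rw [le_iff_psum]
    rintro (_ | d)
    · simp
    · have h1 := m.min_le_psum_succ d
      have h2 := x.psum_le (d + 1)
      rcases le_or_gt (d + 1) (s + 1) with hd | hd
      · obtain ⟨e, he⟩ := Nat.exists_eq_add_of_le hd
        have h3 := x.le_psum_add (d + 1) e (k := s + 1) (by omega)
        rw [← he] at h3
        rw [psum_eq_iff] at hx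
        have h4 : e * 1 ≤ e * x.part (s + 1) := Nat.mul_le_mul_left e (Nat.pos_of_ne_zero hx)
        have h5 := x.psum_le (s + 1 + 1)
        rw [psum_succ] at h5
        omega
      · omega

theorem le_greedy_iff {m : IntPartition n} {t : ℕ} (h : ∀ i, m.psum i = min n (t * i))
    (x : IntPartition n) (ht : t ≤ n) : x ≤ m ↔ x.part 0 ≤ t := by
  constructor
  · intro hx
    have := le_iff_psum.1 hx 1
    rw [psum_one, h] at this
    omega
  · intro hx
    rw [le_iff_psum]
    intro i
    have h1 := x.psum_le i
    have h2 := x.psum_le_mul i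
    have h3 : i * x.part 0 ≤ i * t := Nat.mul_le_mul_left i hx
    rw [h, mul_comm t i]
    omega

theorem primePair_balanced_hook {g m : IntPartition n} {s : ℕ} (hs : 1 ≤ s) (hg : g.psum s = n)
    (hb : g.part 0 ≤ g.part (s - 1) + 1) (hm : m.part 1 ≤ 1) (h0 : m.part 0 + s = n) :
    PrimePair g m := fun x => by
  rw [le_hook_iff hm h0 hs, balanced_le_iff hg hb]

theorem primePair_hook_greedy {g m : IntPartition n} {t : ℕ} (ht : t ≤ n) (hg : g.part 1 ≤ 1)
    (h0 : g.part 0 = t + 1) (hm : ∀ i, m.psum i = min n (t * i)) : PrimePair g m := fun x => by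
  rw [le_greedy_iff hm x ht, hook_le_iff hg, h0]
  omega

/-! ### Construction of partitions -/

/-- The partition with given initial sums. -/
def ofSums (P : ℕ → ℕ) (h0 : P 0 = 0) (hmono : Monotone P)
    (hconc : ∀ i, P i + P (i + 2) ≤ 2 * P (i + 1)) (hn : ∀ i, n ≤ i → P i = n) :
    IntPartition n where
  part i := P (i + 1) - P i
  antitone_part := antitone_nat_of_succ_le fun i => by
    have := hconc i
    rw [add_assoc, one_add_one_eq_two]
    omega
  part_eq_zero i hi := by rw [hn i hi, hn (i + 1) (by omega), Nat.sub_self]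
  sum_part := by rw [Finset.sum_range_tsub hmono, hn n le_rfl, h0, Nat.sub_zero]

theorem psum_ofSums (P : ℕ → ℕ) (h0 : P 0 = 0) (hmono : Monotone P)
    (hconc : ∀ i, P i + P (i + 2) ≤ 2 * P (i + 1)) (hn : ∀ i, n ≤ i → P i = n) (j : ℕ) :
    (ofSums P h0 hmono hconc hn).psum j = P j := by
  change ∑ i ∈ Finset.range j, (P (i + 1) - P i) = P j
  rw [Finset.sum_range_tsub hmono, h0, Nat.sub_zero]

/-- The partition whose initial sums are the minimum of the constant `n` and of two affine
functions. -/
def cap (n A c t : ℕ) : IntPartition n :=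
  -- The slopes are written `A + 1` and `t + 1` to be positive, so that both affine functions have
  -- reached `n` by index `n`.
  ofSums (fun i => min n (min ((A + 1) * i) (c + (t + 1) * i)))
    (by simp)
    (fun i j hij => by
      have h1 := Nat.mul_le_mul_left (A + 1) hij
      have h2 := Nat.mul_le_mul_left (t + 1) hij
      dsimp only
      omega)
    (fun i => by
      have h1 : (A + 1) * (i + 1) = (A + 1) * i + (A + 1) := by ring
      have h2 : (A + 1) * (i + 2) = (A + 1) * i + 2 * (A + 1) := by ring
      have h3 : (t + 1) * (i + 1) = (t + 1) * i + (t + 1) := by ring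
      have h4 : (t + 1) * (i + 2) = (t + 1) * i + 2 * (t + 1) := by ring
      rw [h1, h2, h3, h4]
      omega)
    (fun i hi => by
      have h1 : 1 * i ≤ (A + 1) * i := Nat.mul_le_mul_right i (by omega)
      have h2 : 1 * i ≤ (t + 1) * i := Nat.mul_le_mul_right i (by omega)
      omega)

theorem psum_cap (n A c t i : ℕ) :
    (cap n A c t).psum i = min n (min ((A + 1) * i) (c + (t + 1) * i)) :=
  psum_ofSums _ _ _ _ _ _

theorem exists_balanced {s : ℕ} (hs : 1 ≤ s) (hn : s ≤ n) :
    ∃ g : IntPartition n, g.psum s = n ∧ g.part 0 ≤ g.part (s - 1) + 1 := by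
  have ha : n / s - 1 + 1 = n / s := Nat.sub_add_cancel (Nat.div_pos hn hs)
  have hdiv := Nat.div_add_mod n s
  have hmod := Nat.mod_lt n hs
  -- With `q = n / s` and `r = n % s`, the lines `(q + 1) * i` and `r + q * i` cross at `i = r`, and
  -- the second reaches `n` at `i = s`: this gives `r` entries `q + 1`, then `s - r` entries `q`.
  have h1 : (cap n (n / s) (n % s) (n / s - 1)).psum s = n := by
    rw [psum_cap, ha, Nat.succ_mul, mul_comm (n / s) s]
    omega
  refine ⟨cap n (n / s) (n % s) (n / s - 1), h1, ?_⟩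
  obtain ⟨r, rfl⟩ := Nat.exists_eq_add_of_le' hs
  have h2 := psum_succ (cap n (n / (r + 1)) (n % (r + 1)) (n / (r + 1) - 1)) r
  have h3 := psum_one (cap n (n / (r + 1)) (n % (r + 1)) (n / (r + 1) - 1))
  rw [h1, psum_cap, ha] at h2
  rw [psum_cap, ha] at h3
  rw [Nat.succ_mul, mul_comm r] at hdiv
  rw [Nat.add_sub_cancel]
  omega

theorem exists_hook {k : ℕ} (hk : 1 ≤ k) (hn : k ≤ n) :
    ∃ g : IntPartition n, g.part 0 = k ∧ g.part 1 ≤ 1 := by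
  have h1 := psum_one (cap n (k - 1) (k - 1) 0)
  have h2 := psum_succ (cap n (k - 1) (k - 1) 0) 1
  rw [h1] at h2
  rw [psum_cap] at h1 h2
  exact ⟨cap n (k - 1) (k - 1) 0, by omega, by omega⟩

theorem exists_greedy {t : ℕ} (ht : 1 ≤ t) :
    ∃ m : IntPartition n, ∀ i, m.psum i = min n (t * i) := by
  refine ⟨cap n (t - 1) 0 (t - 1), fun i => ?_⟩
  rw [psum_cap, Nat.sub_add_cancel ht, zero_add, min_self]

end IntPartition

namespace IntPartition

variable {n : ℕ}

/-! ### The types of partitions -/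

theorem typeA_or_typeB_of_balanced {g : IntPartition n} {s : ℕ} (hs : 1 ≤ s) (hsn : s < n)
    (hg : g.psum s = n) (hb : g.part 0 ≤ g.part (s - 1) + 1) : g.TypeA ∨ g.TypeB := by
  have hzero : ∀ i, s ≤ i → g.part i = 0 := fun i hi => by
    have := g.antitone_part hi
    rw [psum_eq_iff] at hg
    omega
  have h0 : 2 ≤ g.part 0 := by
    -- Entries at most 1 would give `n ≤ s`.
    by_contra h
    have h1 := g.psum_le_mul s
    have h2 : s * g.part 0 ≤ s * 1 := Nat.mul_le_mul_left s (by omega)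
    omega
  have hle : ∀ i, g.part i ≤ g.part 0 := fun i => g.antitone_part (Nat.zero_le i)
  by_cases heq : g.part (s - 1) = g.part 0
  · refine Or.inl ⟨g.part 0, s, h0, hs, fun i => ?_⟩
    split_ifs with hi
    · have := g.antitone_part (show i ≤ s - 1 by omega)
      have := hle i
      omega
    · exact hzero i (by omega)
  · have hex : ∃ i, g.part i < g.part 0 := ⟨s - 1, lt_of_le_of_ne (hle _) heq⟩
    classical
    have hfind := Nat.find_spec hex
    have hbs : Nat.find hex ≤ s - 1 := Nat.find_min' hex (lt_of_le_of_ne (hle _) heq)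
    have hmin : ∀ i, i < Nat.find hex → ¬ g.part i < g.part 0 := fun i => Nat.find_min hex
    have hb1 : 1 ≤ Nat.find hex := Nat.one_le_iff_ne_zero.2 fun h => by
      rw [h] at hfind
      exact lt_irrefl _ hfind
    refine Or.inr ⟨g.part 0, Nat.find hex, s - Nat.find hex, h0, hb1, by omega, fun i => ?_⟩
    split_ifs with hi hi'
    · exact le_antisymm (hle i) (not_lt.1 (hmin i hi))
    · have := g.antitone_part (show i ≤ s - 1 by omega)
      have := g.antitone_part (not_lt.1 hi)
      omega
    · exact hzero i (by omega)

theorem TypeA.exists_balanced {g : IntPartition n} (h : g.TypeA) :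
    ∃ s, 1 ≤ s ∧ s < n ∧ g.psum s = n ∧ g.part 0 ≤ g.part (s - 1) + 1 := by
  obtain ⟨k, l, hk, hl, h⟩ := h
  have h0 : g.part 0 = k := by rw [h, if_pos (by omega)]
  have h1 : g.part (l - 1) = k := by rw [h, if_pos (by omega)]
  have hs : g.psum l = n := by rw [psum_eq_iff, h, if_neg (lt_irrefl l)]
  refine ⟨l, hl, ?_, hs, by omega⟩
  have h2 := g.mul_le_psum (i := l) (k := l - 1) (by omega)
  have h3 : l * 2 ≤ l * k := Nat.mul_le_mul_left l hk
  rw [h1] at h2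
  omega

theorem TypeB.exists_balanced {g : IntPartition n} (h : g.TypeB) :
    ∃ s, 1 ≤ s ∧ s < n ∧ g.psum s = n ∧ g.part 0 ≤ g.part (s - 1) + 1 := by
  obtain ⟨k, b, l, hk, hb, hl, h⟩ := h
  have h0 : g.part 0 = k := by rw [h, if_pos (by omega)]
  have h1 : g.part (b + l - 1) = k - 1 := by rw [h, if_neg (by omega), if_pos (by omega)]
  have hs : g.psum (b + l) = n := by rw [psum_eq_iff, h, if_neg (by omega), if_neg (by omega)]
  refine ⟨b + l, by omega, ?_, hs, by omega⟩
  have h2 := g.le_psum_add 1 (b + l - 1) (k := b + l - 1) (by omega)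
  have h3 : (b + l - 1) * 1 ≤ (b + l - 1) * (k - 1) := Nat.mul_le_mul_left _ (by omega)
  rw [h1, show 1 + (b + l - 1) = b + l by omega, psum_one] at h2
  omega

theorem TypeC.part_bounds {g : IntPartition n} (h : g.TypeC) :
    3 ≤ g.part 0 ∧ g.part 0 < n ∧ g.part 1 ≤ 1 := by
  obtain ⟨k, d, hk, hd, h⟩ := h
  have h0 : g.part 0 = k := by rw [h, if_pos (by omega)]
  have h1 : g.part 1 = 1 := by rw [h, if_neg (by omega), if_pos (by omega)]
  have h2 := g.psum_le 2
  rw [psum_succ, psum_one] at h2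
  omega

theorem exists_one_tail {g : IntPartition n} (h1 : g.part 1 ≤ 1) :
    ∃ d, ∀ i, g.part i = if i < 1 then g.part 0 else if i < 1 + d then 1 else 0 := by
  have hex : ∃ i, g.part i = 0 := ⟨n, g.part_eq_zero n le_rfl⟩
  classical
  have hfind := Nat.find_spec hex
  have hmin : ∀ i, i < Nat.find hex → ¬ g.part i = 0 := fun i => Nat.find_min hex
  refine ⟨Nat.find hex - 1, fun i => ?_⟩
  split_ifs with hi hi'
  · rw [Nat.lt_one_iff.1 hi]
  · have := hmin i (by omega)
    have := g.antitone_part (show 1 ≤ i by omega)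
    omega
  · have : Nat.find hex ≤ i := by omega
    have := g.antitone_part this
    omega

theorem typeABC_of_hook {g : IntPartition n} (h0 : 2 ≤ g.part 0) (h1 : g.part 1 ≤ 1) :
    g.TypeABC := by
  obtain ⟨d, hd⟩ := exists_one_tail h1
  rcases Nat.eq_zero_or_pos d with rfl | hpos
  · refine Or.inl ⟨g.part 0, 1, h0, le_rfl, fun i => (hd i).trans ?_⟩
    split_ifs <;> omega
  · rcases h0.eq_or_lt with h2 | h3
    -- Type C requires `k ≥ 3`; a 2 followed by ones is of type B.
    · refine Or.inr (Or.inl ⟨2, 1, d, le_rfl, le_rfl, hpos, fun i => (hd i).trans ?_⟩)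
      rw [← h2]
    · exact Or.inr (Or.inr ⟨g.part 0, d, h3, hpos, hd⟩)

theorem typeI_III_of_hook {m : IntPartition n} (h0 : 1 ≤ m.part 0) (hn : m.part 0 < n)
    (h1 : m.part 1 ≤ 1) : m.TypeI_III := by
  obtain ⟨d, hd⟩ := exists_one_tail h1
  have hpos : 1 ≤ d := Nat.one_le_iff_ne_zero.2 fun hzero => by
    have h2 : m.part 1 = 0 := by rw [hd, if_neg (by omega), if_neg (by omega)]
    rw [← psum_eq_iff, psum_one] at h2
    omega
  rcases h0.eq_or_lt with h2 | h2
  · refine Or.inl ⟨1, 1 + d, le_rfl, by omega, fun i => (hd i).trans ?_⟩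
    split_ifs <;> omega
  · rcases hpos.eq_or_lt with rfl | h3
    · exact Or.inr (Or.inl ⟨m.part 0, 1, 1, le_rfl, h2, le_rfl, hd⟩)
    · exact Or.inr (Or.inr ⟨m.part 0, d, h2, h3, hd⟩)

theorem typeI_III_of_greedy {m : IntPartition n} {t : ℕ} (ht : 1 ≤ t) (htn : t < n)
    (h : ∀ i, m.psum i = min n (t * i)) : m.TypeI_III := by
  have hpart : ∀ i, m.part i = min n (t * i + t) - min n (t * i) := fun i => by
    have := m.psum_succ i
    rw [h, h, Nat.mul_succ] at this
    omega
  have hdiv := Nat.div_add_mod n t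
  have hmod := Nat.mod_lt n ht
  have hc : 1 ≤ n / t := Nat.div_pos htn.le ht
  have hlt : ∀ i, i < n / t → m.part i = t := fun i hi => by
    have : t * (i + 1) ≤ t * (n / t) := Nat.mul_le_mul_left t hi
    rw [Nat.mul_succ] at this
    rw [hpart]
    omega
  have heq : m.part (n / t) = n % t := by
    rw [hpart]
    omega
  have hgt : ∀ i, n / t + 1 ≤ i → m.part i = 0 := fun i hi => by
    have : t * (n / t + 1) ≤ t * i := Nat.mul_le_mul_left t hi
    rw [Nat.mul_succ] at this
    rw [hpart]
    omega
  have hform : ∀ i, m.part i = if i < n / t then t else if i < n / t + 1 then n % t else 0 := by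
    intro i
    split_ifs with h1 h2
    · exact hlt i h1
    · rw [show i = n / t by omega, heq]
    · exact hgt i (by omega)
  rcases Nat.eq_zero_or_pos (n % t) with hr | hr
  · refine Or.inl ⟨t, n / t, ht, ?_, fun i => (hform i).trans ?_⟩
    · by_contra hlt
      rw [show n / t = 1 by omega] at hdiv
      omega
    · rw [hr, ite_self]
  · exact Or.inr (Or.inl ⟨t, n % t, n / t, hr, hmod, hc, hform⟩)

/-- The sums grow by exactly `t` until the last nonzero entry, after which they equal `n`. -/
theorem psum_eq_min_of_greedy {m : IntPartition n} {t : ℕ} (h0 : m.part 0 ≤ t)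
    (h : ∀ i, m.part i = t ∨ m.part (i + 1) = 0) (i : ℕ) : m.psum i = min n (t * i) := by
  have hor : ∀ i, m.psum i = n ∨ m.psum i = t * i := by
    intro i
    induction i with
    | zero => simp
    | succ i ih =>
      rcases ih with ih | ih
      · have h1 := m.psum_mono (Nat.le_succ i)
        have := m.psum_le (i + 1)
        simp only [Nat.succ_eq_add_one] at h1
        omega
      · rcases h i with h | h
        · rw [psum_succ, ih, h]
          exact Or.inr rfl
        · exact Or.inl (m.psum_eq_iff.2 h)
  have h1 := m.psum_le i
  have h2 := m.psum_le_mul i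
  have h3 : i * m.part 0 ≤ i * t := Nat.mul_le_mul_left i h0
  rw [mul_comm i t] at h3
  have := hor i
  omega

theorem TypeABC.exists_primePair {g : IntPartition n} (h : g.TypeABC) :
    ∃ m : IntPartition n, m.TypeI_III ∧ PrimePair g m := by
  have hAB : (∃ s, 1 ≤ s ∧ s < n ∧ g.psum s = n ∧ g.part 0 ≤ g.part (s - 1) + 1) →
      ∃ m : IntPartition n, m.TypeI_III ∧ PrimePair g m := by
    rintro ⟨s, hs, hsn, hg, hb⟩
    obtain ⟨m, hm0, hm1⟩ := exists_hook (n := n) (k := n - s) (by omega) (by omega)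
    exact ⟨m, typeI_III_of_hook (by omega) (by omega) hm1,
      primePair_balanced_hook hs hg hb hm1 (by omega)⟩
  rcases h with h | h | h
  · exact hAB h.exists_balanced
  · exact hAB h.exists_balanced
  · obtain ⟨h3, hn, h1⟩ := h.part_bounds
    obtain ⟨m, hm⟩ := exists_greedy (n := n) (t := g.part 0 - 1) (by omega)
    exact ⟨m, typeI_III_of_greedy (by omega) (by omega) hm,
      primePair_hook_greedy (by omega) h1 (by omega) hm⟩

theorem exists_primePair_of_greedy {m : IntPartition n} {t : ℕ} (ht : 1 ≤ t) (htn : t < n)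
    (h : ∀ i, m.psum i = min n (t * i)) : ∃ g : IntPartition n, g.TypeABC ∧ PrimePair g m := by
  obtain ⟨g, hg0, hg1⟩ := exists_hook (n := n) (k := t + 1) (by omega) (by omega)
  exact ⟨g, typeABC_of_hook (by omega) hg1, primePair_hook_greedy htn.le hg1 hg0 h⟩

theorem TypeI_III.exists_primePair {m : IntPartition n} (h : m.TypeI_III) :
    ∃ g : IntPartition n, g.TypeABC ∧ PrimePair g m := by
  rcases h with ⟨t, c, ht, hc, h⟩ | ⟨t, r, c, hr, hrt, hc, h⟩ | ⟨e, c, he, hc, h⟩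
  · have h0 : m.part 0 = t := by rw [h, if_pos (by omega)]
    have h1 : m.part 1 = t := by rw [h, if_pos (by omega)]
    have h2 := m.psum_le 2
    rw [psum_succ, psum_one] at h2
    refine exists_primePair_of_greedy ht (by omega) (psum_eq_min_of_greedy h0.le fun i => ?_)
    rw [h, h]
    split_ifs <;> omega
  · have h0 : m.part 0 = t := by rw [h, if_pos (by omega)]
    have h1 : 1 ≤ m.part 1 := by
      rw [h]
      split_ifs <;> omega
    have h2 := m.psum_le 2
    rw [psum_succ, psum_one] at h2
    refine exists_primePair_of_greedy (by omega) (by omega)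
      (psum_eq_min_of_greedy h0.le fun i => ?_)
    rw [h, h]
    split_ifs <;> omega
  · have h0 : m.part 0 = e := by rw [h, if_pos (by omega)]
    have h1 : m.part 1 = 1 := by rw [h, if_neg (by omega), if_pos (by omega)]
    have h2 := m.psum_le 2
    rw [psum_succ, psum_one] at h2
    obtain ⟨g, hg, hb⟩ := exists_balanced (n := n) (s := n - e) (by omega) (by omega)
    exact ⟨g, (typeA_or_typeB_of_balanced (by omega) (by omega) hg hb).elim Or.inl
      fun h => Or.inr (Or.inl h), primePair_balanced_hook (by omega) hg hb h1.le (by omega)⟩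

/-- The drop from at least 3 to 1 excludes balanced partitions, and a second entry of at least 3
excludes hooks. -/
theorem TypeD.not_typeABC {g : IntPartition n} (h : g.TypeD) : ¬ g.TypeABC := by
  obtain ⟨k, b, l, d, hk, hbl, hl, hd, h⟩ := h
  have h0 : 3 ≤ g.part 0 := by
    rw [h]
    split_ifs <;> omega
  have h1 : 3 ≤ g.part 1 := by
    rw [h]
    split_ifs <;> omega
  have hone : g.part (b + l) = 1 := by
    rw [h, if_neg (by omega), if_neg (by omega), if_pos (by omega)]
  have hbal : ¬ ∃ s, 1 ≤ s ∧ s < n ∧ g.psum s = n ∧ g.part 0 ≤ g.part (s - 1) + 1 := by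
    rintro ⟨s, hs, -, hg, hb⟩
    rw [psum_eq_iff] at hg
    rcases le_or_gt s (b + l) with hle | hlt
    · have := g.antitone_part hle
      omega
    · have := g.antitone_part (show b + l ≤ s - 1 by omega)
      omega
  rintro (h | h | h)
  · exact hbal h.exists_balanced
  · exact hbal h.exists_balanced
  · have := h.part_bounds
    omega

/-! ### The prime pairs of partitions -/

/-- In a prime pair, the principal filter is cut out by a single initial sum. -/
theorem exists_psum_of_primePair {g m : IntPartition n} (h : PrimePair g m) :
    ∃ j, m.psum j < g.psum j ∧ ∀ x : IntPartition n, g.psum j ≤ x.psum j → g ≤ x := by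
  have hnot := h.not_le
  rw [le_iff_psum] at hnot
  push Not at hnot
  obtain ⟨j, hj⟩ := hnot
  refine ⟨j, hj, fun x hx => by_contra fun hgx => ?_⟩
  have := le_iff_psum.1 ((h x).2 hgx) j
  omega

theorem typeABC_of_part_zero_le_two {g m : IntPartition n} (h : PrimePair g m)
    (h0 : g.part 0 ≤ 2) : g.TypeABC := by
  have hex : ∃ i, g.part i = 0 := ⟨n, g.part_eq_zero n le_rfl⟩
  classical
  have hfind := Nat.find_spec hex
  have hpos : ∀ i, i < Nat.find hex → ¬ g.part i = 0 := fun i => Nat.find_min hex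
  have hs : g.psum (Nat.find hex) = n := g.psum_eq_iff.2 hfind
  have hn : Nat.find hex ≤ n := Nat.find_min' hex (g.part_eq_zero n le_rfl)
  generalize Nat.find hex = s at *
  have hn0 : n ≠ 0 := by
    rintro rfl
    refine h.not_le (le_iff_psum.2 fun j => ?_)
    have := g.psum_le j
    omega
  have hs1 : 1 ≤ s := Nat.one_le_iff_ne_zero.2 fun hz => by
    rw [hz, psum_zero] at hs
    omega
  have hlast := hpos (s - 1) (by omega)
  rcases hn.eq_or_lt with rfl | hsn
  -- With `n` nonzero parts, `g` is the all-ones partition, which lies below `m`.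
  · refine absurd (le_iff_psum.2 fun j => ?_) h.not_le
    rcases le_or_gt s j with hj | hj
    · rw [psum_of_le g hj, psum_of_le m hj]
    · have h1 := g.le_psum_add j (s - j) (k := s - 1) (by omega)
      have h2 : (s - j) * 1 ≤ (s - j) * g.part (s - 1) := Nat.mul_le_mul_left _ (by omega)
      rw [Nat.add_sub_cancel' hj.le] at h1
      obtain ⟨i, rfl⟩ | rfl : (∃ i, j = i + 1) ∨ j = 0 := by
        rcases j with _ | j
        · exact Or.inr rfl
        · exact Or.inl ⟨j, rfl⟩
      · have h3 := m.min_le_psum_succ i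
        have h4 : 1 ≤ m.part 0 := Nat.one_le_iff_ne_zero.2 fun hz => by
          rw [← psum_eq_iff, psum_zero] at hz
          omega
        omega
      · simp
  · exact (typeA_or_typeB_of_balanced hs1 hsn hs (by omega)).elim Or.inl
      fun h => Or.inr (Or.inl h)

/-- Let `q = g.psum j`, so that `g` is the least partition with `j`-th sum at least `q`. If `q = n`
it is balanced, and if `j = 1` it is a hook. If `q ≤ 2 * j`, a partition with entries at most 2
already reaches `q`, so `g.part 0 ≤ 2`. The remaining case is impossible. -/
theorem typeABC_of_primePair {g m : IntPartition n} (h : PrimePair g m) : g.TypeABC := by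
  obtain ⟨j, hj, hmin⟩ := exists_psum_of_primePair h
  have hj1 : 1 ≤ j := Nat.one_le_iff_ne_zero.2 fun hz => by
    rw [hz] at hj
    simp at hj
  have hqn := g.psum_le j
  have hjn : j < n := by
    by_contra hge
    rw [psum_of_le m (by omega)] at hj
    omega
  have hmj : j ≤ m.psum j := by
    obtain ⟨i, rfl⟩ := Nat.exists_eq_add_of_le' hj1
    have h3 := m.min_le_psum_succ i
    have h4 : 1 ≤ m.part 0 := Nat.one_le_iff_ne_zero.2 fun hz => by
      rw [← psum_eq_iff, psum_zero] at hz
      omega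
    omega
  rcases hqn.eq_or_lt with hq | hq
  · obtain ⟨b, hbs, hb⟩ := exists_balanced (n := n) hj1 hjn.le
    obtain rfl : g = b :=
      le_antisymm (hmin b (by omega)) ((balanced_le_iff hbs hb g).2 hq)
    exact (typeA_or_typeB_of_balanced hj1 hjn hbs hb).elim Or.inl fun h => Or.inr (Or.inl h)
  rcases hj1.eq_or_lt with rfl | hj2
  · simp only [psum_one] at hj hq hmj
    obtain ⟨b, hb0, hb1⟩ := exists_hook (n := n) (k := g.part 0) (by omega) hq.le
    obtain rfl : g = b :=
      le_antisymm (hmin b (by rw [psum_one, psum_one, hb0])) ((hook_le_iff hb1 g).2 hb0.le)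
    exact typeABC_of_hook (by omega) hb1
  rcases le_or_gt (2 * j + 1) (g.psum j) with hq2 | hq2
  · exfalso
    obtain ⟨i, rfl⟩ := Nat.exists_eq_add_of_le' hj1
    obtain ⟨u, hu⟩ := Nat.exists_eq_add_of_le hq2
    -- Here `j = i + 1`. This hook and the partition below, with first entry `u + 2` followed by
    -- twos, have `j`-th sum `q - 1`, so both lie below `m`. The hook has `(j - 1)`-th sum `q - 2`
    -- and the other has `(j + 1)`-th sum `q + 1`; concavity then gives `2 * m.psum j ≥ 2 * q - 1`,
    -- contradicting `m.psum j < q`.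
    have hx : cap n (i + u + 1) (i + u + 1) 0 ≤ m := (h _).2 fun hle => by
      have := le_iff_psum.1 hle (i + 1)
      rw [psum_cap] at this
      omega
    have hy : cap n (u + 1) u 1 ≤ m := (h _).2 fun hle => by
      have := le_iff_psum.1 hle (i + 1)
      rw [psum_cap] at this
      omega
    have hx' := le_iff_psum.1 hx i
    have hy' := le_iff_psum.1 hy (i + 2)
    have hc := m.psum_concave i
    rw [psum_cap] at hx' hy'
    have h1 : (i + u + 1 + 1) * i = i * i + u * i + 2 * i := by ring
    have h2 : (u + 1 + 1) * (i + 2) = 2 * u + u * i + 2 * i + 4 := by ring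
    have h3 : 1 * i ≤ i * i := Nat.mul_le_mul_right i (by omega)
    have h4 : u * 1 ≤ u * i := Nat.mul_le_mul_left u (by omega)
    omega
  · refine typeABC_of_part_zero_le_two h ?_
    have hle : g ≤ cap n 1 (g.psum j - j) 0 := hmin _ (by
      rw [psum_cap]
      omega)
    have := le_iff_psum.1 hle 1
    rw [psum_cap, psum_one] at this
    omega

/-- Balanced partitions are indexed by `1 ≤ s ≤ n - 1` and hooks by first part `3 ≤ k ≤ n - 1`; the
hooks with first part 2 or `n` are already balanced. -/
theorem ncard_typeABC (hn : 3 ≤ n) : {g : IntPartition n | g.TypeABC}.ncard = 2 * n - 4 := by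
  have hne : Nonempty (IntPartition n) := ⟨cap n 0 0 0⟩
  have hF : ∀ s, ∃ g : IntPartition n, s ∈ Set.Icc 1 (n - 1) →
      g.psum s = n ∧ g.part 0 ≤ g.part (s - 1) + 1 := fun s => by
    by_cases hs : s ∈ Set.Icc 1 (n - 1)
    · obtain ⟨g, hg⟩ := exists_balanced (n := n) hs.1 (hs.2.trans (Nat.sub_le n 1))
      exact ⟨g, fun _ => hg⟩
    · exact ⟨hne.some, fun h => absurd h hs⟩
  have hH : ∀ k, ∃ g : IntPartition n, k ∈ Set.Icc 3 (n - 1) →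
      g.part 0 = k ∧ g.part 1 ≤ 1 := fun k => by
    by_cases hk : k ∈ Set.Icc 3 (n - 1)
    · obtain ⟨g, hg⟩ := exists_hook (n := n) (k := k) (le_trans (by norm_num) hk.1)
        (hk.2.trans (Nat.sub_le n 1))
      exact ⟨g, fun _ => hg⟩
    · exact ⟨hne.some, fun h => absurd h hk⟩
  choose F hF using hF
  choose H hH using hH
  have hset : {g : IntPartition n | g.TypeABC} =
      F '' Set.Icc 1 (n - 1) ∪ H '' Set.Icc 3 (n - 1) := by
    ext g
    constructor
    · have hAB : (∃ s, 1 ≤ s ∧ s < n ∧ g.psum s = n ∧ g.part 0 ≤ g.part (s - 1) + 1) →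
          g ∈ F '' Set.Icc 1 (n - 1) := by
        rintro ⟨s, hs, hsn, hg, hb⟩
        have hmem : s ∈ Set.Icc 1 (n - 1) := ⟨hs, by omega⟩
        obtain ⟨h1, h2⟩ := hF s hmem
        exact ⟨s, hmem, le_antisymm ((balanced_le_iff h1 h2 g).2 hg)
          ((balanced_le_iff hg hb _).2 h1)⟩
      rintro (h | h | h)
      · exact Or.inl (hAB h.exists_balanced)
      · exact Or.inl (hAB h.exists_balanced)
      · obtain ⟨h3, hlt, h1⟩ := h.part_bounds
        have hmem : g.part 0 ∈ Set.Icc 3 (n - 1) := ⟨h3, by omega⟩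
        obtain ⟨h4, h5⟩ := hH _ hmem
        exact Or.inr ⟨_, hmem, le_antisymm ((hook_le_iff h5 g).2 h4.le)
          ((hook_le_iff h1 _).2 h4.ge)⟩
    · rintro (⟨s, hs, rfl⟩ | ⟨k, hk, rfl⟩)
      · obtain ⟨h1, h2⟩ := hF s hs
        have hs' := hs.2
        exact (typeA_or_typeB_of_balanced hs.1 (by omega) h1 h2).elim Or.inl
          fun h => Or.inr (Or.inl h)
      · obtain ⟨h1, h2⟩ := hH k hk
        have hk' := hk.1
        exact typeABC_of_hook (by omega) h2
  have hFinj : Set.InjOn F (Set.Icc 1 (n - 1)) := by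
    have key : ∀ s ∈ Set.Icc 1 (n - 1), ∀ t ∈ Set.Icc 1 (n - 1), F s = F t → ¬ s < t := by
      intro s hs t ht hst hlt
      obtain ⟨h1, -⟩ := hF s hs
      -- If `s < t`, the entry at `t - 1` is zero, so balance for `t` bounds all entries by 1 and
      -- yields `n ≤ s`.
      obtain ⟨-, h2⟩ := hF t ht
      rw [← hst] at h2
      have h3 := (F s).antitone_part (show s ≤ t - 1 by omega)
      have h4 := (F s).psum_le_mul s
      have h5 := (F s).psum_eq_iff.1 h1
      have h6 : s * (F s).part 0 ≤ s * 1 := Nat.mul_le_mul_left s (by omega)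
      have := hs.2
      omega
    intro s hs t ht hst
    have := key s hs t ht hst
    have := key t ht s hs hst.symm
    omega
  have hHinj : Set.InjOn H (Set.Icc 3 (n - 1)) := by
    intro s hs t ht hst
    rw [← (hH s hs).1, ← (hH t ht).1, hst]
  have hdisj : Disjoint (F '' Set.Icc 1 (n - 1)) (H '' Set.Icc 3 (n - 1)) := by
    rw [Set.disjoint_left]
    rintro _ ⟨s, hs, rfl⟩ ⟨k, hk, hkF⟩
    obtain ⟨h1, h2⟩ := hF s hs
    obtain ⟨h3, h4⟩ := hH k hk
    rw [hkF] at h3 h4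
    obtain ⟨hk1, hk2⟩ := hk
    rcases hs.1.eq_or_lt with rfl | hlt
    · rw [psum_one] at h1
      omega
    · have := (F s).antitone_part (show 1 ≤ s - 1 by omega)
      omega
  rw [hset, Set.ncard_union_eq hdisj, hFinj.ncard_image, hHinj.ncard_image,
    Set.ncard_eq_toFinset_card', Set.ncard_eq_toFinset_card', Set.toFinset_Icc, Set.toFinset_Icc,
    Nat.card_Icc, Nat.card_Icc]
  omega

end IntPartition

/-! ### Double arrows and the main theorem -/

theorem doubleArrow_typeABC_iff {n : ℕ} {g : JoinIrr (IntPartition n)}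
    {m : MeetIrr (IntPartition n)} (h : DoubleArrow (stdContext (IntPartition n)) g m) :
    (g.1.TypeABC ↔ PrimePair g.1 m.1) ∧ (m.1.TypeI_III ↔ PrimePair g.1 m.1) := by
  refine ⟨⟨fun hg => ?_, IntPartition.typeABC_of_primePair⟩, fun hm => ?_, fun hp => ?_⟩
  -- The prime partner of `g` is the target of its only up-arrow, so it must be `m`.
  · obtain ⟨k, -, hk⟩ := hg.exists_primePair
    rwa [(PrimePair.upArrow_iff (m := ⟨k, hk.completelyMeetIrreducible⟩) hk).1 h.1]
  · obtain ⟨k, -, hk⟩ := hm.exists_primePair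
    rwa [(PrimePair.downArrow_iff (g := ⟨k, hk.completelyJoinIrreducible⟩) hk).1 h.2]
  · obtain ⟨k, hk, hgk⟩ := (IntPartition.typeABC_of_primePair hp).exists_primePair
    rwa [hp.right_unique hgk]

theorem mainTheorem10 (n : ℕ) (hn : 3 ≤ n) :
    -- the number of one-generated arrow-closed subcontexts of format 1×1
    {S : Set (JoinIrr (IntPartition n)) × Set (MeetIrr (IntPartition n)) |
        IsOneGenerated (stdContext (IntPartition n)) S ∧ IsOneByOne S}.ncard = 2 * n - 4 ∧
    -- double arrows are one-to-one between the types A, B, C and the types I, II, III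
    (∀ g : JoinIrr (IntPartition n), g.1.TypeABC →
      ∃! m : MeetIrr (IntPartition n), DoubleArrow (stdContext (IntPartition n)) g m) ∧
    (∀ m : MeetIrr (IntPartition n), m.1.TypeI_III →
      ∃! g : JoinIrr (IntPartition n), DoubleArrow (stdContext (IntPartition n)) g m) ∧
    (∀ (g : JoinIrr (IntPartition n)) (m : MeetIrr (IntPartition n)),
      DoubleArrow (stdContext (IntPartition n)) g m → (g.1.TypeABC ↔ m.1.TypeI_III)) ∧
    -- each double arrow of a generator of type A, B or C is the subcontext that it generates
    (∀ (g : JoinIrr (IntPartition n)) (m : MeetIrr (IntPartition n)), g.1.TypeABC →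
      DoubleArrow (stdContext (IntPartition n)) g m →
      IsArrowClosure (stdContext (IntPartition n)) {g} ∅ ({g}, {m})) ∧
    -- and there are no other one-generated arrow-closed subcontexts of format 1×1
    (∀ S : Set (JoinIrr (IntPartition n)) × Set (MeetIrr (IntPartition n)),
      IsOneGenerated (stdContext (IntPartition n)) S → IsOneByOne S →
      ∃ (g : JoinIrr (IntPartition n)) (m : MeetIrr (IntPartition n)), g.1.TypeABC ∧
        DoubleArrow (stdContext (IntPartition n)) g m ∧ S = ({g}, {m})) ∧
    -- type D generators have at least two up-arrows
    (∀ g : JoinIrr (IntPartition n), g.1.TypeD →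
      ∃ m₁ m₂ : MeetIrr (IntPartition n), m₁ ≠ m₂ ∧
        UpArrow (stdContext (IntPartition n)) g m₁ ∧
        UpArrow (stdContext (IntPartition n)) g m₂) := by
  have hform : ∀ S : Set (JoinIrr (IntPartition n)) × Set (MeetIrr (IntPartition n)),
      IsOneGenerated (stdContext (IntPartition n)) S → IsOneByOne S →
      ∃ (g : JoinIrr (IntPartition n)) (m : MeetIrr (IntPartition n)),
        PrimePair g.1 m.1 ∧ S = ({g}, {m}) :=
    fun S hS h1 => hS.arrowClosed.exists_primePair h1
  refine ⟨?_, ?_, ?_, ?_, ?_, ?_, ?_⟩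
  · rw [← IntPartition.ncard_typeABC hn]
    symm
    -- Each 1×1 subcontext is determined by its object, a partition of type A, B or C; the attribute
    -- is its prime partner.
    refine Set.ncard_congr
      (fun g hg => ({⟨g, hg.exists_primePair.choose_spec.2.completelyJoinIrreducible⟩},
        {⟨hg.exists_primePair.choose,
          hg.exists_primePair.choose_spec.2.completelyMeetIrreducible⟩})) ?_ ?_ ?_
    · intro g hg
      have hp := hg.exists_primePair.choose_spec.2
      exact ⟨Or.inl ⟨_, PrimePair.isArrowClosure hp⟩,
        Set.ncard_singleton _, Set.ncard_singleton _⟩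
    · intro a b ha hb hab
      exact congrArg Subtype.val (Set.singleton_injective (Prod.ext_iff.1 hab).1)
    · rintro S ⟨hS, h1⟩
      obtain ⟨g, m, hp, rfl⟩ := hform S hS h1
      have hg := IntPartition.typeABC_of_primePair hp
      refine ⟨g.1, hg, ?_⟩
      have hm := hp.right_unique hg.exists_primePair.choose_spec.2
      ext x
      · rfl
      · simp only [← hm]
  · intro g hg
    obtain ⟨m, -, hm⟩ := hg.exists_primePair
    refine ⟨⟨m, hm.completelyMeetIrreducible⟩, PrimePair.doubleArrow hm, fun k hk => ?_⟩
    exact (PrimePair.upArrow_iff hm).1 hk.1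
  · intro m hm
    obtain ⟨g, -, hg⟩ := hm.exists_primePair
    refine ⟨⟨g, hg.completelyJoinIrreducible⟩, PrimePair.doubleArrow hg, fun k hk => ?_⟩
    exact (PrimePair.downArrow_iff hg).1 hk.2
  · intro g m h
    obtain ⟨h1, h2⟩ := doubleArrow_typeABC_iff h
    exact h1.trans h2.symm
  · intro g m hg h
    exact ((doubleArrow_typeABC_iff h).1.1 hg).isArrowClosure
  · intro S hS h1
    obtain ⟨g, m, hp, hgm⟩ := hform S hS h1
    exact ⟨g, m, IntPartition.typeABC_of_primePair hp, hp.doubleArrow, hgm⟩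
  · intro g hg
    by_contra! hall
    obtain ⟨m, hp, -⟩ := exists_primePair_of_upArrow_unique g fun k₁ k₂ h₁ h₂ =>
      by_contra fun hne => hall k₁ k₂ hne h₁ h₂
    exact hg.not_typeABC (IntPartition.typeABC_of_primePair hp)
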